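/- Let $d_1,d_2\in\mathbb N$, $\beta\in\mathbb R$, $c>0$ and $2\le p<r$. Let $\mu^Y$ be a Borel probability measure on $\mathbb R^{d_2}$ with finite $r$-th moment, $\int|y|^r\,\mathrm d\mu^Y(y)<\infty$. Then there is a constant $C>0$, depending only on $\mu^Y,p,r$ and on the fixed parameters $d_1,d_2,\beta,c$, such that the following holds. Let $\mathcal E:\mathbb R^{d_1}\times\mathbb R^{d_2}\to\mathbb R$ be any cost function with $-c\le\mathcal E\le c$ for which there are $L>0$ and $s\ge 0$ such that $$|\mathcal E(z_0)-\mathcal E(z_1)|\le L\,(1+|z_0|+|z_1|)^s\,|z_0-z_1|\qquad\text{for all }z_0,z_1\in\mathbb R^{d_1+d_2}.$$ For a probability measure $\mu$ on $\mathbb R^{d_2}$ with finite first moment and $x\in\mathbb R^{d_1}$, let $$\mathbb Y_\beta(\mu,x):=\frac{\int y\,e^{\beta\mathcal E(x,y)}\,\mathrm d\mu(y)}{\int e^{\beta\mathcal E(x,y)}\,\mathrm d\mu(y)}$$ be the weighted mean. Let $Y^1,Y^2,\dots$ be i.i.d. random vectors with law $\mu^Y$ on any probability space, and let $\mu^{Y,N}=\frac1N\sum_{j=1}^N\delta_{Y^j}$.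 Then for all integers $N\ge 1$ $$\sup_{x\in\mathbb R^{d_1}}\mathbb E\,\bigl|\mathbb Y_\beta(\mu^{Y,N},x)-\mathbb Y_\beta(\mu^Y,x)\bigr|^p\le C\,N^{-p/2}.$$ -/

import Mathlib

open MeasureTheory ProbabilityTheory
open scoped ENNReal

namespace MinMaxCBO

/-- The set `𝒫_r(ℝᵈ)` of Borel probability measures on `ℝᵈ` with finite `r`-th moment
`∫ |y|^r dμ(y) < ∞`. -/
def finiteMomentMeasures (d : ℕ) (r : ℝ) : Set (Measure (EuclideanSpace ℝ (Fin d))) :=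
  {μ | IsProbabilityMeasure μ ∧ ∫⁻ y, ‖y‖ₑ ^ r ∂μ < ∞}

/-- Boundedness of the cost function: `-c ≤ ℰ(x, y) ≤ c` for all `x, y`. -/
def BoundedCost {d₁ d₂ : ℕ}
    (ℰ : EuclideanSpace ℝ (Fin d₁) → EuclideanSpace ℝ (Fin d₂) → ℝ) (c : ℝ) : Prop :=
  ∀ x y, -c ≤ ℰ x y ∧ ℰ x y ≤ c

/-- Lipschitz property with polynomial growth: there are `L > 0` and `s ≥ 0` with
`|ℰ(z₀) - ℰ(z₁)| ≤ L (1 + |z₀| + |z₁|)^s |z₀ - z₁|` for all `z₀ = (x₀, y₀)` and `z₁ = (x₁, y₁)`.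
Here `WithLp 2 (_ × _)` carries the Euclidean norm of `ℝ^(d₁ + d₂)`. -/
def PolyLipschitzCost {d₁ d₂ : ℕ}
    (ℰ : EuclideanSpace ℝ (Fin d₁) → EuclideanSpace ℝ (Fin d₂) → ℝ) : Prop :=
  ∃ L : ℝ, 0 < L ∧ ∃ s : ℝ, 0 ≤ s ∧
    ∀ z₀ z₁ : WithLp 2 (EuclideanSpace ℝ (Fin d₁) × EuclideanSpace ℝ (Fin d₂)),
      |ℰ z₀.fst z₀.snd - ℰ z₁.fst z₁.snd| ≤ L * (1 + ‖z₀‖ + ‖z₁‖) ^ s * ‖z₀ - z₁‖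

/-- The weight `ω_γ(x, y) = exp(-γ ℰ(x, y))`. -/
noncomputable def weight {d₁ d₂ : ℕ}
    (ℰ : EuclideanSpace ℝ (Fin d₁) → EuclideanSpace ℝ (Fin d₂) → ℝ) (γ : ℝ)
    (x : EuclideanSpace ℝ (Fin d₁)) (y : EuclideanSpace ℝ (Fin d₂)) : ℝ :=
  Real.exp (-γ * ℰ x y)

/-- The weighted mean `𝕐_β(μ, x) = (∫ y ω_{-β}(x, y) dμ(y)) / (∫ ω_{-β}(x, y) dμ(y))`. -/
noncomputable def consensusY {d₁ d₂ : ℕ}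
    (ℰ : EuclideanSpace ℝ (Fin d₁) → EuclideanSpace ℝ (Fin d₂) → ℝ) (β : ℝ)
    (μ : Measure (EuclideanSpace ℝ (Fin d₂))) (x : EuclideanSpace ℝ (Fin d₁)) :
    EuclideanSpace ℝ (Fin d₂) :=
  (∫ y, weight ℰ (-β) x y ∂μ)⁻¹ • ∫ y, weight ℰ (-β) x y • y ∂μ

/-- The empirical measure `(1/N) ∑_{j < N} δ_{v j}` of the first `N` terms of a sequence. -/
noncomputable def empiricalMeasure {d : ℕ} (N : ℕ) (v : ℕ → EuclideanSpace ℝ (Fin d)) :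
    Measure (EuclideanSpace ℝ (Fin d)) :=
  (N : ℝ≥0∞)⁻¹ • ∑ j ∈ Finset.range N, Measure.dirac (v j)

end MinMaxCBO

/-!
The weighted mean of the empirical measure is the center of mass of the samples with weights
`w (Y i)`, and its error is `(∑ i, w (Y i))⁻¹ • ∑ i, w (Y i) • (Y i - m)`, where `m` is the weighted
mean of the law. By the choice of `m` the summands of the second sum are centered, and the first
sum is at least a constant times the number of samples. So everything rests on the
Marcinkiewicz–Zygmund inequality `‖∑ i, Z i‖² ≤ C_p ∑ i, ‖Z i‖²` in `L^p`, for independent centered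
`Z i` with values in a Hilbert space. Adding one summand at a time, it reduces to
`‖X + Z‖² ≤ ‖X‖² + C_p ‖Z‖²` in `L^p`, which follows from the second-order expansion of `‖·‖ ^ p`:
its linear term has mean zero because `Z` is centered and independent of `X`.
-/

lemma mul_rpow_sub_one_mul_le {t a b : ℝ} (ht : 1 ≤ t) (ha : 0 ≤ a) (hb : 0 ≤ b) :
    t * (a ^ (t - 1) * b) ≤ (t - 1) * a ^ t + b ^ t := by
  have ht0 : 0 < t := by linarith
  have amgm := Real.geom_mean_le_arith_mean2_weighted (w₁ := (t - 1) / t) (w₂ := 1 / t)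
    (div_nonneg (by linarith) ht0.le) (by positivity) (Real.rpow_nonneg ha t)
    (Real.rpow_nonneg hb t) (by field_simp; ring)
  rw [← Real.rpow_mul ha, ← Real.rpow_mul hb, mul_div_cancel₀ _ ht0.ne',
    mul_one_div_cancel ht0.ne', Real.rpow_one] at amgm
  calc t * (a ^ (t - 1) * b) ≤ t * ((t - 1) / t * a ^ t + 1 / t * b ^ t) := by gcongr
    _ = (t - 1) * a ^ t + b ^ t := by field_simp

lemma rpow_add_mul_le_add_two_mul_rpow {q α β C : ℝ} (hq : 1 ≤ q) (hα : 0 ≤ α) (hβ : 0 ≤ β)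
    (hC : 1 ≤ 2 * C) :
    α ^ q + C * (α ^ (q - 1) * β + β ^ q) ≤ (α + 2 * C * β) ^ q := by
  have hγ : 0 ≤ 2 * C * β := mul_nonneg (by linarith) hβ
  have tangent : α ^ q + 2 * C * (α ^ (q - 1) * β) ≤ (α + 2 * C * β) ^ q := by
    have young := mul_rpow_sub_one_mul_le hq hα (add_nonneg hα hγ)
    have hpow : α ^ (q - 1) * α = α ^ q := by
      rw [← Real.rpow_add_one' hα (by linarith), sub_add_cancel]
    have : 0 ≤ (q - 1) * (2 * C * (α ^ (q - 1) * β)) :=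
      mul_nonneg (by linarith) (by positivity)
    linear_combination young + this - q * hpow
  have superadditive : α ^ q + 2 * C * β ^ q ≤ (α + 2 * C * β) ^ q := by
    have hCq : 2 * C ≤ (2 * C) ^ q := Real.self_le_rpow_of_one_le hC hq
    calc α ^ q + 2 * C * β ^ q ≤ α ^ q + (2 * C * β) ^ q := by
          rw [Real.mul_rpow (by positivity) hβ]; gcongr
      _ ≤ (α + 2 * C * β) ^ q := Real.add_rpow_le_rpow_add hα hγ hq
  linarith

section NormPow

variable {E : Type*} [NormedAddCommGroup E]

lemma max_norm_add_rpow_le {q : ℝ} (hq : 0 ≤ q) (x z : E) :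
    max ‖x + z‖ ‖x‖ ^ q ≤ 2 ^ q * (‖x‖ ^ q + ‖z‖ ^ q) := by
  have hmax : max ‖x + z‖ ‖x‖ ≤ 2 * max ‖x‖ ‖z‖ :=
    max_le ((norm_add_le x z).trans (by grind)) (by grind [norm_nonneg x])
  calc max ‖x + z‖ ‖x‖ ^ q ≤ (2 * max ‖x‖ ‖z‖) ^ q := by gcongr
    _ = 2 ^ q * max (‖x‖ ^ q) (‖z‖ ^ q) := by
        rw [Real.mul_rpow (by norm_num) (by positivity),
          (Real.monotoneOn_rpow_Ici_of_exponent_nonneg hq).map_max (norm_nonneg x)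
            (norm_nonneg z)]
    _ ≤ 2 ^ q * (‖x‖ ^ q + ‖z‖ ^ q) := by
        gcongr
        exact max_le_add_of_nonneg (by positivity) (by positivity)

variable [NormedSpace ℝ E]

lemma norm_norm_rpow_smul {q : ℝ} (hq : 0 ≤ q) (v : E) : ‖‖v‖ ^ q • v‖ = ‖v‖ ^ (q + 1) := by
  rw [norm_smul, Real.norm_of_nonneg (by positivity), Real.rpow_add_one' (norm_nonneg v)
    (by linarith)]

lemma norm_norm_rpow_smul_sub_le {q : ℝ} (hq : 0 ≤ q) (u v : E) :
    ‖‖u‖ ^ q • u - ‖v‖ ^ q • v‖ ≤ (q + 1) * max ‖u‖ ‖v‖ ^ q * ‖u - v‖ := by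
  wlog huv : ‖v‖ ≤ ‖u‖ generalizing u v
  · rw [norm_sub_rev, max_comm, norm_sub_rev u v]
    exact this v u (le_of_not_ge huv)
  have hpow : ‖v‖ ^ q ≤ ‖u‖ ^ q := by gcongr
  have scalar : (‖u‖ ^ q - ‖v‖ ^ q) * ‖v‖ ≤ q * ‖u‖ ^ q * (‖u‖ - ‖v‖) := by
    have young := mul_rpow_sub_one_mul_le (t := q + 1) (by linarith) (norm_nonneg u)
      (norm_nonneg v)
    rw [add_sub_cancel_right, Real.rpow_add_one' (norm_nonneg u) (by linarith),
      Real.rpow_add_one' (norm_nonneg v) (by linarith)] at young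
    linarith
  calc ‖‖u‖ ^ q • u - ‖v‖ ^ q • v‖
      = ‖‖u‖ ^ q • (u - v) + (‖u‖ ^ q - ‖v‖ ^ q) • v‖ := by congr 1; module
    _ ≤ ‖u‖ ^ q * ‖u - v‖ + (‖u‖ ^ q - ‖v‖ ^ q) * ‖v‖ := by
        refine (norm_add_le _ _).trans_eq ?_
        rw [norm_smul, norm_smul, Real.norm_of_nonneg (by positivity),
          Real.norm_of_nonneg (sub_nonneg.2 hpow)]
    _ ≤ ‖u‖ ^ q * ‖u - v‖ + q * ‖u‖ ^ q * ‖u - v‖ := by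
        grw [scalar, norm_sub_norm_le u v]
    _ = (q + 1) * max ‖u‖ ‖v‖ ^ q * ‖u - v‖ := by rw [max_eq_left huv]; ring

end NormPow

/-- The constant of the second-order bound `norm_add_rpow_le` for `‖·‖ ^ p`: the gradient
`p ‖v‖ ^ (p - 2) • v` contributes `p (p - 1)` through its local Lipschitz constant, and
`2 ^ (p - 2)` comes from bounding `‖x + z‖` in terms of `‖x‖` and `‖z‖`. -/
noncomputable def secondOrderConst (p : ℝ) : ℝ := p * (p - 1) * 2 ^ (p - 2)

lemma two_le_secondOrderConst {p : ℝ} (hp : 2 ≤ p) : 2 ≤ secondOrderConst p := by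
  have : (1 : ℝ) ≤ 2 ^ (p - 2) := Real.one_le_rpow (by norm_num) (by linarith)
  rw [secondOrderConst]
  nlinarith [mul_nonneg (sub_nonneg.2 hp) (sub_nonneg.2 hp)]

section Inner

variable {E : Type*} [NormedAddCommGroup E] [InnerProductSpace ℝ E]

lemma norm_rpow_sub_le_inner {p : ℝ} (hp : 2 ≤ p) (u v : E) :
    ‖u‖ ^ p - ‖v‖ ^ p ≤ p * inner ℝ (‖u‖ ^ (p - 2) • u) (u - v) := by
  have young := mul_rpow_sub_one_mul_le (by linarith : 1 ≤ p) (norm_nonneg u) (norm_nonneg v)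
  have hself : inner ℝ (‖u‖ ^ (p - 2) • u) u = ‖u‖ ^ p := by
    rw [real_inner_smul_left, real_inner_self_eq_norm_sq, ← Real.rpow_natCast,
      ← Real.rpow_add' (norm_nonneg u) (by norm_num; linarith)]
    norm_num
  have hcross : inner ℝ (‖u‖ ^ (p - 2) • u) v ≤ ‖u‖ ^ (p - 1) * ‖v‖ := by
    refine (real_inner_le_norm _ _).trans_eq ?_
    rw [norm_norm_rpow_smul (by linarith)]
    ring_nf
  rw [inner_sub_right, hself]
  nlinarith

lemma norm_add_rpow_le {p : ℝ} (hp : 2 ≤ p) (x z : E) :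
    ‖x + z‖ ^ p ≤ ‖x‖ ^ p + p * inner ℝ (‖x‖ ^ (p - 2) • x) z
      + secondOrderConst p * (‖x‖ ^ (p - 2) * ‖z‖ ^ 2 + ‖z‖ ^ p) := by
  have hp2 : 0 ≤ p - 2 := by linarith
  set φ : E → E := fun v => ‖v‖ ^ (p - 2) • v
  have hlip : ‖φ (x + z) - φ x‖ ≤ (p - 1) * max ‖x + z‖ ‖x‖ ^ (p - 2) * ‖z‖ := by
    convert norm_norm_rpow_smul_sub_le hp2 (x + z) x using 2
    · ring
    · rw [add_sub_cancel_left]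
  have hzp : ‖z‖ ^ (p - 2) * ‖z‖ ^ 2 = ‖z‖ ^ p := by
    rw [← Real.rpow_natCast, ← Real.rpow_add' (norm_nonneg z) (by norm_num; linarith)]
    norm_num
  calc ‖x + z‖ ^ p ≤ ‖x‖ ^ p + p * inner ℝ (φ (x + z)) z := by
        have := norm_rpow_sub_le_inner hp (x + z) x
        rw [add_sub_cancel_left] at this
        linarith
    _ = ‖x‖ ^ p + p * inner ℝ (φ x) z + p * inner ℝ (φ (x + z) - φ x) z := by
        rw [inner_sub_left]; ring
    _ ≤ ‖x‖ ^ p + p * inner ℝ (φ x) z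
        + p * ((p - 1) * (2 ^ (p - 2) * (‖x‖ ^ (p - 2) + ‖z‖ ^ (p - 2))) * ‖z‖ * ‖z‖) := by
        have hp1 : 0 ≤ p - 1 := by linarith
        grw [real_inner_le_norm (φ (x + z) - φ x) z, hlip, max_norm_add_rpow_le hp2]
    _ = _ := by rw [secondOrderConst, ← hzp]; ring

end Inner

section Moments

variable {Ω E : Type*} {mΩ : MeasurableSpace Ω} {P : Measure Ω} [NormedAddCommGroup E]

lemma integral_norm_rpow_eq_lpNorm_rpow {X : Ω → E} {p : ℝ} (hp : 0 < p)
    (hX : AEStronglyMeasurable X P) :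
    ∫ ω, ‖X ω‖ ^ p ∂P = lpNorm X (ENNReal.ofReal p) P ^ p := by
  rw [lpNorm_eq_integral_norm_rpow_toReal (by simpa using hp) ENNReal.ofReal_ne_top hX,
    ENNReal.toReal_ofReal hp.le, Real.rpow_inv_rpow (by positivity) hp.ne']

lemma integrable_norm_rpow_of_le [IsFiniteMeasure P] {X : Ω → E} {p a : ℝ}
    (hX : MemLp X (ENNReal.ofReal p) P) (ha : 0 ≤ a) (hap : a ≤ p) :
    Integrable (fun ω => ‖X ω‖ ^ a) P := by
  have h := (hX.mono_exponent (ENNReal.ofReal_le_ofReal hap)).integrable_norm_rpow'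
  rwa [ENNReal.toReal_ofReal ha] at h

lemma integral_norm_rpow_le_lpNorm_rpow [IsProbabilityMeasure P] {X : Ω → E} {p a : ℝ}
    (hp : 0 < p) (hX : MemLp X (ENNReal.ofReal p) P) (ha : 0 ≤ a) (hap : a ≤ p) :
    ∫ ω, ‖X ω‖ ^ a ∂P ≤ lpNorm X (ENNReal.ofReal p) P ^ a := by
  have hpow (t : ℝ) (ht : 0 ≤ t) : (t ^ p) ^ (a / p) = t ^ a := by
    rw [← Real.rpow_mul ht, mul_div_cancel₀ _ hp.ne']
  have jensen := (Real.concaveOn_rpow (div_nonneg ha hp.le)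
    ((div_le_one hp).2 hap)).le_map_integral (μ := P) (f := fun ω => ‖X ω‖ ^ p)
    (Real.continuous_rpow_const (div_nonneg ha hp.le)).continuousOn isClosed_Ici
    (ae_of_all _ fun ω => Set.mem_Ici.2 (by positivity))
    (integrable_norm_rpow_of_le hX hp.le le_rfl)
    (by simpa only [Function.comp_def, hpow _ (norm_nonneg _)]
      using integrable_norm_rpow_of_le hX ha hap)
  simpa only [hpow _ (norm_nonneg _), integral_norm_rpow_eq_lpNorm_rpow hp hX.1,
    hpow _ lpNorm_nonneg] using jensen

end Moments

section MarcinkiewiczZygmund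

variable {Ω E : Type*} {mΩ : MeasurableSpace Ω} {P : Measure Ω} [IsProbabilityMeasure P]
  [NormedAddCommGroup E] [InnerProductSpace ℝ E] [CompleteSpace E]
  [MeasurableSpace E] [BorelSpace E] [SecondCountableTopology E] {p : ℝ}

lemma integral_inner_norm_rpow_smul_eq_zero {X Z : Ω → E} (hp : 2 ≤ p)
    (hXZ : IndepFun X Z P) (hX : MemLp X (ENNReal.ofReal p) P)
    (hZ : MemLp Z (ENNReal.ofReal p) P) (hZ0 : ∫ ω, Z ω ∂P = 0) :
    Integrable (fun ω => inner ℝ (‖X ω‖ ^ (p - 2) • X ω) (Z ω)) P ∧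
      ∫ ω, inner ℝ (‖X ω‖ ^ (p - 2) • X ω) (Z ω) ∂P = 0 := by
  have hφ : Measurable fun x : E => ‖x‖ ^ (p - 2) • x := by fun_prop
  have hφX : Integrable (fun ω => ‖X ω‖ ^ (p - 2) • X ω) P := by
    refine (integrable_norm_iff
      (hφ.comp_aemeasurable hX.1.aemeasurable).aestronglyMeasurable).1 ?_
    simp only [Function.comp_apply, norm_norm_rpow_smul (sub_nonneg.2 hp)]
    exact integrable_norm_rpow_of_le hX (by linarith) (by linarith)
  have hind : IndepFun (fun ω => ‖X ω‖ ^ (p - 2) • X ω) Z P := hXZ.comp hφ measurable_id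
  have hZ1 : Integrable Z P := hZ.integrable (ENNReal.one_le_ofReal.2 (by linarith))
  refine ⟨hind.integrable_bilin hφX hZ1 (innerSL ℝ), ?_⟩
  have := hind.integral_bilin hφX hZ1 (innerSL ℝ)
  rwa [hZ0, map_zero] at this

lemma integral_norm_add_rpow_le_of_indepFun {X Z : Ω → E} (hp : 2 ≤ p)
    (hXZ : IndepFun X Z P) (hX : MemLp X (ENNReal.ofReal p) P)
    (hZ : MemLp Z (ENNReal.ofReal p) P) (hZ0 : ∫ ω, Z ω ∂P = 0) :
    ∫ ω, ‖X ω + Z ω‖ ^ p ∂P ≤ ∫ ω, ‖X ω‖ ^ p ∂P + secondOrderConst p *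
      ((∫ ω, ‖X ω‖ ^ (p - 2) ∂P) * (∫ ω, ‖Z ω‖ ^ 2 ∂P) + ∫ ω, ‖Z ω‖ ^ p ∂P) := by
  have hp0 : 0 ≤ p := by linarith
  have hXp := integrable_norm_rpow_of_le hX hp0 le_rfl
  have hZp := integrable_norm_rpow_of_le hZ hp0 le_rfl
  have hX2 := integrable_norm_rpow_of_le hX (sub_nonneg.2 hp) (by linarith)
  have hZ2 : Integrable (fun ω => ‖Z ω‖ ^ 2) P := by
    exact_mod_cast integrable_norm_rpow_of_le hZ zero_le_two hp
  obtain ⟨hinner, hinner0⟩ := integral_inner_norm_rpow_smul_eq_zero hp hXZ hX hZ hZ0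
  have hind : IndepFun (fun ω => ‖X ω‖ ^ (p - 2)) (fun ω => ‖Z ω‖ ^ 2) P :=
    hXZ.comp (measurable_norm.pow_const (p - 2)) (measurable_norm.pow_const 2)
  have hprod : Integrable (fun ω => ‖X ω‖ ^ (p - 2) * ‖Z ω‖ ^ 2) P :=
    hind.integrable_mul hX2 hZ2
  have hlin := hXp.add (hinner.const_mul p)
  have hrem := (hprod.add hZp).const_mul (secondOrderConst p)
  calc ∫ ω, ‖X ω + Z ω‖ ^ p ∂P
      ≤ ∫ ω, ((‖X ω‖ ^ p + p * inner ℝ (‖X ω‖ ^ (p - 2) • X ω) (Z ω))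
        + secondOrderConst p * (‖X ω‖ ^ (p - 2) * ‖Z ω‖ ^ 2 + ‖Z ω‖ ^ p)) ∂P :=
        integral_mono (integrable_norm_rpow_of_le (hX.add hZ) hp0 le_rfl)
          (hlin.add hrem) fun ω => norm_add_rpow_le hp (X ω) (Z ω)
    _ = _ := by
        rw [integral_add (by exact hlin) (by exact hrem),
          integral_add hXp (hinner.const_mul p), integral_const_mul, hinner0,
          integral_const_mul, integral_add hprod hZp,
          hind.integral_fun_mul_eq_mul_integral hX2.1 hZ2.1]
        ring

lemma lpNorm_add_sq_le_of_indepFun {X Z : Ω → E} (hp : 2 ≤ p)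
    (hXZ : IndepFun X Z P) (hX : MemLp X (ENNReal.ofReal p) P)
    (hZ : MemLp Z (ENNReal.ofReal p) P) (hZ0 : ∫ ω, Z ω ∂P = 0) :
    lpNorm (X + Z) (ENNReal.ofReal p) P ^ 2 ≤ lpNorm X (ENNReal.ofReal p) P ^ 2
      + 2 * secondOrderConst p * lpNorm Z (ENNReal.ofReal p) P ^ 2 := by
  have hp0 : 0 < p := by linarith
  have hC := two_le_secondOrderConst hp
  set A := lpNorm X (ENNReal.ofReal p) P
  set B := lpNorm Z (ENNReal.ofReal p) P
  have hA : 0 ≤ A := lpNorm_nonneg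
  have hB : 0 ≤ B := lpNorm_nonneg
  have hsq (t q : ℝ) (ht : 0 ≤ t) : (t ^ 2) ^ (q / 2) = t ^ q := by
    rw [← Real.rpow_natCast_mul ht]
    ring_nf
  have hX2 : ∫ ω, ‖X ω‖ ^ (p - 2) ∂P ≤ A ^ (p - 2) :=
    integral_norm_rpow_le_lpNorm_rpow hp0 hX (sub_nonneg.2 hp) (by linarith)
  have hZ2 : ∫ ω, ‖Z ω‖ ^ 2 ∂P ≤ B ^ 2 := by
    exact_mod_cast integral_norm_rpow_le_lpNorm_rpow hp0 hZ zero_le_two hp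
  have key : (lpNorm (X + Z) (ENNReal.ofReal p) P ^ 2) ^ (p / 2)
      ≤ (A ^ 2 + 2 * secondOrderConst p * B ^ 2) ^ (p / 2) := by
    calc (lpNorm (X + Z) (ENNReal.ofReal p) P ^ 2) ^ (p / 2)
        = ∫ ω, ‖X ω + Z ω‖ ^ p ∂P := by
          rw [hsq _ _ lpNorm_nonneg, ← integral_norm_rpow_eq_lpNorm_rpow hp0 (hX.add hZ).1]
          rfl
      _ ≤ A ^ p + secondOrderConst p * (A ^ (p - 2) * B ^ 2 + B ^ p) := by
          refine (integral_norm_add_rpow_le_of_indepFun hp hXZ hX hZ hZ0).trans ?_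
          rw [integral_norm_rpow_eq_lpNorm_rpow hp0 hX.1,
            integral_norm_rpow_eq_lpNorm_rpow hp0 hZ.1]
          gcongr
      _ = (A ^ 2) ^ (p / 2) + secondOrderConst p *
            ((A ^ 2) ^ (p / 2 - 1) * B ^ 2 + (B ^ 2) ^ (p / 2)) := by
          rw [show p / 2 - 1 = (p - 2) / 2 by ring, hsq _ _ hA, hsq _ _ hA, hsq _ _ hB]
      _ ≤ _ := rpow_add_mul_le_add_two_mul_rpow (by linarith) (by positivity)
          (by positivity) (by linarith)
  exact (Real.rpow_le_rpow_iff (by positivity) (by positivity) (by positivity)).1 key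

theorem lpNorm_sum_sq_le_of_iIndepFun {ι : Type*} {Z : ι → Ω → E} (hp : 2 ≤ p)
    (hind : iIndepFun Z P) (hZ : ∀ i, MemLp (Z i) (ENNReal.ofReal p) P)
    (hZ0 : ∀ i, ∫ ω, Z i ω ∂P = 0) (s : Finset ι) :
    lpNorm (∑ i ∈ s, Z i) (ENNReal.ofReal p) P ^ 2
      ≤ 2 * secondOrderConst p * ∑ i ∈ s, lpNorm (Z i) (ENNReal.ofReal p) P ^ 2 := by
  classical
  induction s using Finset.induction_on with
  | empty => simp
  | insert i s hi ih =>
    have hsi : IndepFun (∑ j ∈ s, Z j) (Z i) P :=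
      hind.indepFun_finsetSum_of_notMem₀ (fun j => (hZ j).1.aemeasurable) hi
    rw [Finset.sum_insert hi, Finset.sum_insert hi, add_comm (Z i)]
    have := lpNorm_add_sq_le_of_indepFun hp hsi (memLp_finsetSum' s fun j _ => hZ j) (hZ i)
      (hZ0 i)
    linarith

end MarcinkiewiczZygmund

/-- The mean of `μ` reweighted by `w`. It takes the junk value `0` if `w` is not integrable or has
integral `0`. -/
noncomputable def weightedMean {E : Type*} [NormedAddCommGroup E] [NormedSpace ℝ E]
    [MeasurableSpace E] (w : E → ℝ) (μ : Measure E) : E :=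
  (∫ y, w y ∂μ)⁻¹ • ∫ y, w y • y ∂μ

section CenterMass

variable {ι E : Type*} [NormedAddCommGroup E] [NormedSpace ℝ E] {s : Finset ι} {w : ι → ℝ}

lemma norm_smul_le_of_mem_Icc {a b t : ℝ} (ha : 0 ≤ a) (ht : t ∈ Set.Icc a b) (v : E) :
    ‖t • v‖ ≤ b * ‖v‖ := by
  rw [norm_smul, Real.norm_of_nonneg (ha.trans ht.1)]
  gcongr
  exact ht.2

lemma centerMass_sub_eq (hw : ∑ i ∈ s, w i ≠ 0) (z : ι → E) (m : E) :
    s.centerMass w z - m = (∑ i ∈ s, w i)⁻¹ • ∑ i ∈ s, w i • (z i - m) := by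
  simp only [smul_sub, Finset.sum_sub_distrib, ← Finset.sum_smul, inv_smul_smul₀ hw,
    Finset.centerMass]

lemma norm_centerMass_sub_le {a : ℝ} (ha : 0 < a) (hs : s.Nonempty) (hw : ∀ i ∈ s, a ≤ w i)
    (z : ι → E) (m : E) :
    ‖s.centerMass w z - m‖ ≤ (s.card * a)⁻¹ * ‖∑ i ∈ s, w i • (z i - m)‖ := by
  have hcard : 0 < (s.card : ℝ) * a := mul_pos (by exact_mod_cast hs.card_pos) ha
  have hsum : s.card * a ≤ ∑ i ∈ s, w i := by
    simpa only [nsmul_eq_mul] using s.card_nsmul_le_sum w a hw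
  have hpos : 0 < ∑ i ∈ s, w i := hcard.trans_le hsum
  rw [centerMass_sub_eq hpos.ne', norm_smul, norm_inv, Real.norm_of_nonneg hpos.le]
  gcongr

end CenterMass

section WeightedMean

variable {E : Type*} [MeasurableSpace E] {μ : Measure E} {w : E → ℝ} {a b : ℝ}

lemma le_integral_of_mem_Icc [IsProbabilityMeasure μ] (hw : Measurable w)
    (hwab : ∀ y, w y ∈ Set.Icc a b) : a ≤ ∫ y, w y ∂μ := by
  simpa using integral_mono (integrable_const a)
    (Integrable.of_mem_Icc (μ := μ) a b hw.aemeasurable (ae_of_all _ hwab)) fun y => (hwab y).1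

variable [NormedAddCommGroup E] [NormedSpace ℝ E]

lemma memLp_smul_sub [IsFiniteMeasure μ] {q : ℝ≥0∞} (ha : 0 ≤ a) (hw : Measurable w)
    (hwab : ∀ y, w y ∈ Set.Icc a b) (hμ : MemLp id q μ) (m : E) :
    MemLp (fun y => w y • (y - m)) q μ :=
  (hμ.sub (memLp_const m)).of_le_mul
    (hw.aestronglyMeasurable.smul (hμ.1.sub aestronglyMeasurable_const))
    (ae_of_all _ fun y => norm_smul_le_of_mem_Icc ha (hwab y) (y - m))

variable [IsProbabilityMeasure μ]

lemma integral_smul_sub_weightedMean [CompleteSpace E] (ha : 0 < a) (hw : Measurable w)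
    (hwab : ∀ y, w y ∈ Set.Icc a b) (hμ : Integrable id μ) :
    ∫ y, w y • (y - weightedMean w μ) ∂μ = 0 := by
  have hpos : 0 < ∫ y, w y ∂μ := ha.trans_le (le_integral_of_mem_Icc hw hwab)
  have hint : Integrable w μ := .of_mem_Icc a b hw.aemeasurable (ae_of_all _ hwab)
  have hsmul : Integrable (fun y => w y • y) μ := by
    simpa only [sub_zero] using
      (memLp_smul_sub ha.le hw hwab (memLp_one_iff_integrable.2 hμ) 0).integrable le_rfl
  simp_rw [smul_sub]
  rw [integral_sub hsmul (hint.smul_const _), integral_smul_const, weightedMean,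
    smul_inv_smul₀ hpos.ne', sub_self]

lemma norm_weightedMean_le (ha : 0 < a) (hw : Measurable w)
    (hwab : ∀ y, w y ∈ Set.Icc a b) (hμ : Integrable id μ) :
    ‖weightedMean w μ‖ ≤ b / a * ∫ y, ‖y‖ ∂μ := by
  have hden := le_integral_of_mem_Icc (μ := μ) hw hwab
  have hnum : ‖∫ y, w y • y ∂μ‖ ≤ b * ∫ y, ‖y‖ ∂μ := by
    rw [← integral_const_mul]
    exact norm_integral_le_of_norm_le (hμ.norm.const_mul b)
      (ae_of_all _ fun y => norm_smul_le_of_mem_Icc ha.le (hwab y) y)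
  rw [weightedMean, norm_smul, norm_inv, Real.norm_of_nonneg (ha.le.trans hden),
    div_eq_inv_mul, mul_assoc]
  gcongr

lemma lpNorm_smul_sub_weightedMean_le {p : ℝ} (hp : 1 ≤ p) (ha : 0 < a) (hw : Measurable w)
    (hwab : ∀ y, w y ∈ Set.Icc a b) (hμ : MemLp id (ENNReal.ofReal p) μ) :
    lpNorm (fun y => w y • (y - weightedMean w μ)) (ENNReal.ofReal p) μ
      ≤ b * (1 + b / a) * lpNorm id (ENNReal.ofReal p) μ := by
  have hp0 : 0 < p := by linarith
  have hp1 : 1 ≤ ENNReal.ofReal p := ENNReal.one_le_ofReal.2 hp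
  have hb : 0 < b := ha.trans_le ((hwab 0).1.trans (hwab 0).2)
  set m := weightedMean w μ
  have hmean : ‖m‖ ≤ b / a * lpNorm id (ENNReal.ofReal p) μ := by
    have hmoment : ∫ y, ‖y‖ ∂μ ≤ lpNorm id (ENNReal.ofReal p) μ := by
      simpa using integral_norm_rpow_le_lpNorm_rpow hp0 hμ zero_le_one hp
    grw [norm_weightedMean_le ha hw hwab (hμ.integrable hp1), hmoment]
  have hμsub : MemLp (fun y => y - m) (ENNReal.ofReal p) μ := hμ.sub (memLp_const m)
  calc lpNorm (fun y => w y • (y - m)) (ENNReal.ofReal p) μ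
      ≤ lpNorm (b • fun y => ‖y - m‖) (ENNReal.ofReal p) μ :=
        lpNorm_mono_real (hμsub.norm.const_smul b)
          fun y => norm_smul_le_of_mem_Icc ha.le (hwab y) _
    _ = b * lpNorm (fun y => y - m) (ENNReal.ofReal p) μ := by
        rw [lpNorm_const_smul, coe_nnnorm, Real.norm_of_nonneg hb.le,
          lpNorm_norm hμsub.1]
    _ ≤ b * (lpNorm id (ENNReal.ofReal p) μ + ‖m‖) := by
        gcongr
        refine (lpNorm_sub_le hμ hp1 (g := fun _ => m)).trans_eq ?_
        rw [lpNorm_const' (by simpa using hp0) ENNReal.ofReal_ne_top]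
        simp
    _ ≤ b * (1 + b / a) * lpNorm id (ENNReal.ofReal p) μ := by
        grw [hmean]
        linarith

end WeightedMean

section HasLaw

variable {Ω 𝓨 F : Type*} {mΩ : MeasurableSpace Ω} {m𝓨 : MeasurableSpace 𝓨} {P : Measure Ω}
  {μ : Measure 𝓨} {Y : Ω → 𝓨} [NormedAddCommGroup F] {g : 𝓨 → F} {q : ℝ≥0∞}

lemma memLp_comp_of_hasLaw (hY : HasLaw Y μ P) (hg : MemLp g q μ) : MemLp (g ∘ Y) q P :=
  .comp_of_map (hY.map_eq ▸ hg) hY.aemeasurable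

lemma lpNorm_comp_of_hasLaw (hY : HasLaw Y μ P) (hg : AEStronglyMeasurable g μ) :
    lpNorm (g ∘ Y) q P = lpNorm g q μ := by
  obtain rfl := hY.map_eq
  rw [← toReal_eLpNorm hg, ← toReal_eLpNorm (hg.comp_aemeasurable hY.aemeasurable),
    eLpNorm_map_measure hg hY.aemeasurable]

end HasLaw

lemma memLp_centerMass_sub {Ω E ι : Type*} {mΩ : MeasurableSpace Ω} {P : Measure Ω}
    [NormedAddCommGroup E] [NormedSpace ℝ E] [MeasurableSpace E] [BorelSpace E]
    [SecondCountableTopology E] {μ : Measure E} [IsFiniteMeasure μ] {Y : ι → Ω → E}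
    {w : E → ℝ} {a b : ℝ} {q : ℝ≥0∞} (ha : 0 < a) (hw : Measurable w)
    (hwab : ∀ y, w y ∈ Set.Icc a b) (hμ : MemLp id q μ) (hY : ∀ i, HasLaw (Y i) μ P)
    {s : Finset ι} (hs : s.Nonempty) (m : E) :
    MemLp (fun ω => s.centerMass (fun i => w (Y i ω)) (fun i => Y i ω) - m) q P := by
  have hterm (i : ι) : MemLp (fun ω => w (Y i ω) • (Y i ω - m)) q P :=
    memLp_comp_of_hasLaw (hY i) (memLp_smul_sub ha.le hw hwab hμ m)
  have hsum : AEMeasurable (fun ω => ∑ i ∈ s, w (Y i ω)) P :=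
    s.aemeasurable_fun_sum fun i _ => hw.comp_aemeasurable (hY i).aemeasurable
  have hsum_smul : AEMeasurable (fun ω => ∑ i ∈ s, w (Y i ω) • Y i ω) P :=
    s.aemeasurable_fun_sum fun i _ =>
      (hw.comp_aemeasurable (hY i).aemeasurable).smul (hY i).aemeasurable
  exact (memLp_finsetSum s fun i _ => hterm i).of_le_mul
    ((hsum.inv.smul hsum_smul).sub_const m).aestronglyMeasurable
    (ae_of_all _ fun ω => norm_centerMass_sub_le ha hs (fun i _ => (hwab _).1) _ m)

section EmpiricalMean

variable {Ω E ι : Type*} {mΩ : MeasurableSpace Ω} {P : Measure Ω}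
  [NormedAddCommGroup E] [InnerProductSpace ℝ E] [CompleteSpace E]
  [MeasurableSpace E] [BorelSpace E] [SecondCountableTopology E]
  [IsProbabilityMeasure P] {p : ℝ}

lemma lpNorm_sum_comp_sq_le {𝓨 : Type*} {m𝓨 : MeasurableSpace 𝓨} {μ : Measure 𝓨}
    {Y : ι → Ω → 𝓨} (hp : 2 ≤ p) (hY : ∀ i, HasLaw (Y i) μ P) (hind : iIndepFun Y P)
    {g : 𝓨 → E} (hg : Measurable g) (hgp : MemLp g (ENNReal.ofReal p) μ)
    (hg0 : ∫ y, g y ∂μ = 0) (s : Finset ι) :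
    lpNorm (∑ i ∈ s, g ∘ Y i) (ENNReal.ofReal p) P ^ 2
      ≤ 2 * secondOrderConst p * s.card * lpNorm g (ENNReal.ofReal p) μ ^ 2 := by
  refine (lpNorm_sum_sq_le_of_iIndepFun hp (hind.comp (fun _ => g) fun _ => hg)
    (fun i => memLp_comp_of_hasLaw (hY i) hgp)
    (fun i => ((hY i).integral_comp hgp.1).trans hg0) s).trans_eq ?_
  simp only [lpNorm_comp_of_hasLaw (hY _) hgp.1, Finset.sum_const, nsmul_eq_mul]
  ring

variable {μ : Measure E} [IsProbabilityMeasure μ] {Y : ι → Ω → E} {w : E → ℝ} {a b : ℝ}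

theorem lpNorm_centerMass_sub_weightedMean_le (hp : 2 ≤ p) (ha : 0 < a)
    (hw : Measurable w) (hwab : ∀ y, w y ∈ Set.Icc a b)
    (hμ : MemLp id (ENNReal.ofReal p) μ) (hY : ∀ i, HasLaw (Y i) μ P) (hind : iIndepFun Y P)
    {s : Finset ι} (hs : s.Nonempty) :
    lpNorm (fun ω => s.centerMass (fun i => w (Y i ω)) (fun i => Y i ω) - weightedMean w μ)
        (ENNReal.ofReal p) P
      ≤ b / a * (1 + b / a) * √(2 * secondOrderConst p) * lpNorm id (ENNReal.ofReal p) μ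
        / √s.card := by
  have : 0 < (s.card : ℝ) := by exact_mod_cast hs.card_pos
  have hC : 0 ≤ 2 * secondOrderConst p := by linarith [two_le_secondOrderConst hp]
  set g : E → E := fun y => w y • (y - weightedMean w μ)
  have hg : Measurable g := by fun_prop
  have hgp : MemLp g (ENNReal.ofReal p) μ := memLp_smul_sub ha.le hw hwab hμ _
  have hg0 : ∫ y, g y ∂μ = 0 := integral_smul_sub_weightedMean ha hw hwab
    (hμ.integrable (ENNReal.one_le_ofReal.2 (by linarith)))
  have hgY : MemLp (∑ i ∈ s, g ∘ Y i) (ENNReal.ofReal p) P :=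
    memLp_finsetSum' s fun i _ => memLp_comp_of_hasLaw (hY i) hgp
  have hsum : lpNorm (∑ i ∈ s, g ∘ Y i) (ENNReal.ofReal p) P
      ≤ √(2 * secondOrderConst p * s.card) * lpNorm g (ENNReal.ofReal p) μ := by
    refine abs_le_of_sq_le_sq' ?_ (mul_nonneg (Real.sqrt_nonneg _) lpNorm_nonneg) |>.2
    rw [mul_pow, Real.sq_sqrt (by positivity)]
    exact lpNorm_sum_comp_sq_le hp hY hind hg hgp hg0 s
  calc lpNorm (fun ω => s.centerMass (fun i => w (Y i ω)) (fun i => Y i ω) - weightedMean w μ)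
        (ENNReal.ofReal p) P
      ≤ lpNorm ((s.card * a)⁻¹ • fun ω => ‖(∑ i ∈ s, g ∘ Y i) ω‖) (ENNReal.ofReal p) P :=
        lpNorm_mono_real (hgY.norm.const_smul _) fun ω => by
          simpa [g] using norm_centerMass_sub_le ha hs (fun i _ => (hwab _).1) _ _
    _ = (s.card * a)⁻¹ * lpNorm (∑ i ∈ s, g ∘ Y i) (ENNReal.ofReal p) P := by
        rw [lpNorm_const_smul, coe_nnnorm, Real.norm_of_nonneg (by positivity),
          lpNorm_norm hgY.1]
    _ ≤ (s.card * a)⁻¹ * (√(2 * secondOrderConst p * s.card)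
          * (b * (1 + b / a) * lpNorm id (ENNReal.ofReal p) μ)) := by
        grw [hsum, lpNorm_smul_sub_weightedMean_le (by linarith) ha hw hwab hμ]
    _ = _ := by
        rw [Real.sqrt_mul hC]
        field_simp
        rw [Real.sq_sqrt (Nat.cast_nonneg _)]
        ring

lemma integral_norm_centerMass_sub_weightedMean_rpow_le (hp : 2 ≤ p) (ha : 0 < a)
    (hw : Measurable w) (hwab : ∀ y, w y ∈ Set.Icc a b)
    (hμ : MemLp id (ENNReal.ofReal p) μ) (hY : ∀ i, HasLaw (Y i) μ P) (hind : iIndepFun Y P)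
    {s : Finset ι} (hs : s.Nonempty) :
    ∫ ω, ‖s.centerMass (fun i => w (Y i ω)) (fun i => Y i ω) - weightedMean w μ‖ ^ p ∂P
      ≤ (b / a * (1 + b / a) * √(2 * secondOrderConst p) * lpNorm id (ENNReal.ofReal p) μ) ^ p
        * (s.card : ℝ) ^ (-(p / 2)) := by
  have hp0 : 0 < p := by linarith
  have hb : 0 < b := ha.trans_le ((hwab 0).1.trans (hwab 0).2)
  have hscale : √(s.card : ℝ) ^ p = (s.card : ℝ) ^ (p / 2) := by
    rw [Real.sqrt_eq_rpow, ← Real.rpow_mul (by positivity), one_div_mul_eq_div]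
  rw [integral_norm_rpow_eq_lpNorm_rpow hp0 (memLp_centerMass_sub ha hw hwab hμ hY hs _).1,
    Real.rpow_neg (by positivity), ← hscale, ← div_eq_mul_inv,
    ← Real.div_rpow (mul_nonneg (by positivity) lpNorm_nonneg) (Real.sqrt_nonneg _)]
  exact Real.rpow_le_rpow lpNorm_nonneg
    (lpNorm_centerMass_sub_weightedMean_le hp ha hw hwab hμ hY hind hs) hp0.le

end EmpiricalMean

namespace MinMaxCBO

lemma finiteMomentMeasures_anti {d : ℕ} {p r : ℝ} (hp : 0 ≤ p) (hpr : p ≤ r) :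
    finiteMomentMeasures d r ⊆ finiteMomentMeasures d p := by
  rintro μ ⟨hμ, hr⟩
  refine ⟨hμ, ?_⟩
  calc ∫⁻ y, ‖y‖ₑ ^ p ∂μ ≤ ∫⁻ y, (1 + ‖y‖ₑ ^ r) ∂μ := by
        refine lintegral_mono fun y => ?_
        rcases le_total ‖y‖ₑ 1 with hy | hy
        · exact (ENNReal.rpow_le_one hy hp).trans le_self_add
        · exact (ENNReal.rpow_le_rpow_of_exponent_le hy hpr).trans le_add_self
    _ < ∞ := by
        rw [lintegral_add_left measurable_const, lintegral_one, measure_univ]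
        exact ENNReal.add_lt_top.2 ⟨ENNReal.one_lt_top, hr⟩

lemma memLp_id_of_mem_finiteMomentMeasures {d : ℕ} {p : ℝ} (hp : 0 < p)
    {μ : Measure (EuclideanSpace ℝ (Fin d))} (hμ : μ ∈ finiteMomentMeasures d p) :
    MemLp id (ENNReal.ofReal p) μ := by
  refine ⟨aestronglyMeasurable_id, (eLpNorm_lt_top_iff_lintegral_rpow_enorm_lt_top
    (by simpa using hp) ENNReal.ofReal_ne_top).2 ?_⟩
  rw [ENNReal.toReal_ofReal hp.le]
  exact hμ.2

variable {d₁ d₂ : ℕ} {ℰ : EuclideanSpace ℝ (Fin d₁) → EuclideanSpace ℝ (Fin d₂) → ℝ}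

lemma PolyLipschitzCost.continuous_right (hL : PolyLipschitzCost ℰ)
    (x : EuclideanSpace ℝ (Fin d₁)) : Continuous (ℰ x) := by
  obtain ⟨L, -, s, hs, h⟩ := hL
  let z (y : EuclideanSpace ℝ (Fin d₂)) :
      WithLp 2 (EuclideanSpace ℝ (Fin d₁) × EuclideanSpace ℝ (Fin d₂)) := WithLp.toLp 2 (x, y)
  refine continuous_iff_continuousAt.2 fun y₀ => tendsto_iff_norm_sub_tendsto_zero.2 ?_
  have hbound : Continuous fun y => L * (1 + ‖z y‖ + ‖z y₀‖) ^ s * ‖z y - z y₀‖ :=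
    (continuous_const.mul (.rpow_const (by fun_prop) fun _ => .inr hs)).mul (by fun_prop)
  exact squeeze_zero (fun _ => norm_nonneg _) (fun y => h (z y) (z y₀))
    (by simpa using hbound.tendsto y₀)

lemma BoundedCost.weight_mem_Icc {c : ℝ} (hb : BoundedCost ℰ c) (γ : ℝ)
    (x : EuclideanSpace ℝ (Fin d₁)) (y : EuclideanSpace ℝ (Fin d₂)) :
    weight ℰ γ x y ∈ Set.Icc (Real.exp (-(|γ| * c))) (Real.exp (|γ| * c)) := by
  have habs : |-γ * ℰ x y| ≤ |γ| * c := by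
    rw [abs_mul, abs_neg]
    gcongr
    exact abs_le.2 (hb x y)
  exact ⟨Real.exp_le_exp.2 (abs_le.1 habs).1, Real.exp_le_exp.2 (abs_le.1 habs).2⟩

lemma integral_empiricalMeasure {d : ℕ} {F : Type*} [NormedAddCommGroup F] [NormedSpace ℝ F]
    [CompleteSpace F] (N : ℕ) (v : ℕ → EuclideanSpace ℝ (Fin d))
    (f : EuclideanSpace ℝ (Fin d) → F) :
    ∫ y, f y ∂empiricalMeasure N v = (N : ℝ)⁻¹ • ∑ j ∈ Finset.range N, f (v j) := by
  rw [empiricalMeasure, integral_smul_measure, integral_finsetSum_measure]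
  · simp
  · exact fun j _ => integrable_dirac (by finiteness)

lemma consensusY_eq_weightedMean (β : ℝ) (μ : Measure (EuclideanSpace ℝ (Fin d₂)))
    (x : EuclideanSpace ℝ (Fin d₁)) :
    consensusY ℰ β μ x = weightedMean (weight ℰ (-β) x) μ := rfl

lemma consensusY_empiricalMeasure (β : ℝ) {N : ℕ} (hN : N ≠ 0)
    (v : ℕ → EuclideanSpace ℝ (Fin d₂)) (x : EuclideanSpace ℝ (Fin d₁)) :
    consensusY ℰ β (empiricalMeasure N v) x
      = (Finset.range N).centerMass (fun j => weight ℰ (-β) x (v j)) v := by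
  have : (N : ℝ) ≠ 0 := by exact_mod_cast hN
  rw [consensusY, integral_empiricalMeasure, integral_empiricalMeasure, smul_eq_mul, mul_inv,
    inv_inv, smul_smul, mul_right_comm, mul_inv_cancel₀ this, one_mul, Finset.centerMass]

end MinMaxCBO

theorem lemma2p7_general (d₁ d₂ : ℕ) (β c p : ℝ) (hp : 2 ≤ p)
    (μ : Measure (EuclideanSpace ℝ (Fin d₂))) (hμ : μ ∈ MinMaxCBO.finiteMomentMeasures d₂ p) :
    ∃ C : ℝ, 0 < C ∧
      ∀ ℰ : EuclideanSpace ℝ (Fin d₁) → EuclideanSpace ℝ (Fin d₂) → ℝ,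
        MinMaxCBO.BoundedCost ℰ c → (∀ x, Measurable (ℰ x)) →
      ∀ (Ω : Type*) (_ : MeasurableSpace Ω) (P : Measure Ω) (_ : IsProbabilityMeasure P)
        (Y : ℕ → Ω → EuclideanSpace ℝ (Fin d₂)),
        (∀ j, HasLaw (Y j) μ P) → iIndepFun Y P →
      ∀ N : ℕ, 1 ≤ N → ∀ x : EuclideanSpace ℝ (Fin d₁),
        Integrable (fun ω => ‖MinMaxCBO.consensusY ℰ β
          (MinMaxCBO.empiricalMeasure N (fun j => Y j ω)) x
            - MinMaxCBO.consensusY ℰ β μ x‖ ^ p) P ∧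
        ∫ ω, ‖MinMaxCBO.consensusY ℰ β
          (MinMaxCBO.empiricalMeasure N (fun j => Y j ω)) x
            - MinMaxCBO.consensusY ℰ β μ x‖ ^ p ∂P ≤ C * (N : ℝ) ^ (-(p / 2)) := by
  have hp0 : 0 < p := by linarith
  have := hμ.1
  have hLp := MinMaxCBO.memLp_id_of_mem_finiteMomentMeasures hp0 hμ
  set a := Real.exp (-(|-β| * c))
  set b := Real.exp (|-β| * c)
  set K := b / a * (1 + b / a) * √(2 * secondOrderConst p) * lpNorm id (ENNReal.ofReal p) μ
  have hK : 0 ≤ K := mul_nonneg (by positivity) lpNorm_nonneg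
  refine ⟨K ^ p + 1, by positivity, fun ℰ hb hℰ Ω _ P _ Y hY hind N hN x => ?_⟩
  have ha : 0 < a := Real.exp_pos _
  have hs : (Finset.range N).Nonempty := Finset.nonempty_range_iff.2 (by lia)
  have hw : Measurable (MinMaxCBO.weight ℰ (-β) x) :=
    Real.measurable_exp.comp ((hℰ x).const_mul _)
  have hwab := hb.weight_mem_Icc (-β) x
  simp only [MinMaxCBO.consensusY_empiricalMeasure β (by lia : N ≠ 0)]
  rw [MinMaxCBO.consensusY_eq_weightedMean]
  refine ⟨integrable_norm_rpow_of_le (memLp_centerMass_sub ha hw hwab hLp hY hs _) hp0.le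
    le_rfl, ?_⟩
  calc _ ≤ K ^ p * ((Finset.range N).card : ℝ) ^ (-(p / 2)) :=
        integral_norm_centerMass_sub_weightedMean_rpow_le hp ha hw hwab hLp hY hind hs
    _ ≤ (K ^ p + 1) * (N : ℝ) ^ (-(p / 2)) := by
        rw [Finset.card_range]
        gcongr
        linarith

theorem lemma2p7 (d₁ d₂ : ℕ) (β c : ℝ) (hc : 0 < c) (p r : ℝ) (hp : 2 ≤ p) (hpr : p < r)
    (μ : Measure (EuclideanSpace ℝ (Fin d₂))) (hμ : μ ∈ MinMaxCBO.finiteMomentMeasures d₂ r) :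
    ∃ C : ℝ, 0 < C ∧
      ∀ ℰ : EuclideanSpace ℝ (Fin d₁) → EuclideanSpace ℝ (Fin d₂) → ℝ,
        MinMaxCBO.BoundedCost ℰ c → MinMaxCBO.PolyLipschitzCost ℰ →
      ∀ (Ω : Type*) (_ : MeasurableSpace Ω) (P : Measure Ω) (_ : IsProbabilityMeasure P)
        (Y : ℕ → Ω → EuclideanSpace ℝ (Fin d₂)),
        (∀ j, HasLaw (Y j) μ P) → iIndepFun Y P →
      ∀ N : ℕ, 1 ≤ N → ∀ x : EuclideanSpace ℝ (Fin d₁),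
        Integrable (fun ω => ‖MinMaxCBO.consensusY ℰ β
          (MinMaxCBO.empiricalMeasure N (fun j => Y j ω)) x
            - MinMaxCBO.consensusY ℰ β μ x‖ ^ p) P ∧
        ∫ ω, ‖MinMaxCBO.consensusY ℰ β
          (MinMaxCBO.empiricalMeasure N (fun j => Y j ω)) x
            - MinMaxCBO.consensusY ℰ β μ x‖ ^ p ∂P ≤ C * (N : ℝ) ^ (-(p / 2)) := by
  obtain ⟨C, hC, h⟩ := lemma2p7_general d₁ d₂ β c p hp μ
    (MinMaxCBO.finiteMomentMeasures_anti (by linarith) hpr.le hμ)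
  exact ⟨C, hC, fun ℰ hb hL => h ℰ hb fun x => (hL.continuous_right x).measurable⟩
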